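/- Let $n\ge 1$ and let $X$ be a secret taking values in $\{1,\dots,n\}$ with prior distribution $p=(p(1),\dots,p(n))$, where $p(x)>0$ for every $x$. For a vector $v\in\mathbb{R}^n$ let $v_{[1]}\ge v_{[2]}\ge\dots\ge v_{[n]}$ denote its entries in non-increasing order. A channel consists of a discrete (finite or infinite) output alphabet $\mathcal{Y}$ and numbers $p(y|x)\ge 0$ with $\sum_{y\in\mathcal{Y}}p(y|x)=1$ for every $x$. Put $p(y)=\sum_{x}p(x)p(y|x)$ and $\mathcal{Y}^+=\{y\in\mathcal{Y}:p(y|x)>0\text{ for some }x\}$; for $y\in\mathcal{Y}^+$ let $p_{X|y}=\bigl(p(x)p(y|x)/p(y)\bigr)_{x=1}^{n}$ be the posterior distribution. For $1\le l\le n$ the posterior $l$-guess-error-probability of the channel is $$H_l(X|Y)=\sum_{y\in\mathcal{Y}^+}p(y)\Bigl(1-\sum_{i=1}^{l}(p_{X|y})_{[i]}\Bigr),$$ the probability that an adversary who observes the output is wrong within his $l$ best guesses. Let $1\le k\le n$ and $1\le l\le n$, and consider all channels, with any discrete output alphabet, that satisfy the pre-image cap $|\{x:p(y|x)>0\}|\le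 k$ for every $y\in\mathcal{Y}$. The maximum of $H_l(X|Y)$ over these channels exists, is attained by a channel with a finite output alphabet, and, if $l\le k$, is equal to $$1-\max_{0\le j\le l}\Bigl\{\sum_{i=1}^{j}p_{[i]}+\Bigl(1-\sum_{i=1}^{j}p_{[i]}\Bigr)\frac{l-j}{k-j}\Bigr\},$$ where, in the single case $j=l=k$, the quotient $\frac{l-j}{k-j}$ is read as $0$. If $k<l\le n$, the maximum is $0$. -/

import Mathlib

universe u

noncomputable section

/-- The entries of `v` rearranged in non-increasing order: `sortDesc v i` is the
`(i+1)`-th largest entry `v_[i+1]`, counted with multiplicity. -/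
def sortDesc {n : ℕ} (v : Fin n → ℝ) : Fin n → ℝ :=
  fun i => v (Tuple.sort (fun x => -v x) i)

theorem sortDesc_antitone {n : ℕ} (v : Fin n → ℝ) : Antitone (sortDesc v) := by
  intro i j hij
  have h := Tuple.monotone_sort (fun x => -v x) hij
  simpa [sortDesc] using h

/-- `topSum v j = v_[1] + ⋯ + v_[j]`, the sum of the `j` largest entries of `v`. -/
def topSum {n : ℕ} (v : Fin n → ℝ) (j : ℕ) : ℝ :=
  ∑ i ∈ Finset.univ.filter (fun i : Fin n => (i : ℕ) < j), sortDesc v i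

/-- The `l`-guess-error-probability of a distribution `q`: the probability that none of the
`l` best guesses is correct. -/
def guessError {n : ℕ} (l : ℕ) (q : Fin n → ℝ) : ℝ :=
  1 - topSum q l

/-- A discrete channel with `n` secrets and output alphabet `Y`; `prob x y` is `p(y|x)`. -/
structure Channel (n : ℕ) (Y : Type*) where
  prob : Fin n → Y → ℝ
  prob_nonneg : ∀ x y, 0 ≤ prob x y
  prob_hasSum : ∀ x, HasSum (prob x) 1

namespace Channel

variable {n : ℕ} {Y : Type*}

/-- The secrets that produce the output `y` with positive probability. -/
def preIm (W : Channel n Y) (y : Y) : Set (Fin n) :=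
  {x | 0 < W.prob x y}

/-- The outputs that are produced with positive probability by some secret. -/
def posOutputs (W : Channel n Y) : Set Y :=
  {y | ∃ x, 0 < W.prob x y}

/-- Every pre-image has at most `k` elements. -/
def PreImCap (W : Channel n Y) (k : ℕ) : Prop :=
  ∀ y, (W.preIm y).ncard ≤ k

/-- The total probability `p(y)` of the output `y` under the prior `p`. -/
def outProb (W : Channel n Y) (p : Fin n → ℝ) (y : Y) : ℝ :=
  ∑ x, p x * W.prob x y

/-- The posterior distribution `p(x|y)`, by Bayes' rule. -/
def posterior (W : Channel n Y) (p : Fin n → ℝ) (y : Y) : Fin n → ℝ :=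
  fun x => p x * W.prob x y / W.outProb p y

/-- The posterior `l`-guess-error-probability `H(X|Y)`. -/
def posteriorGuessError (W : Channel n Y) (p : Fin n → ℝ) (l : ℕ) : ℝ :=
  ∑' y : W.posOutputs, W.outProb p y * guessError l (W.posterior p y)

end Channel

/-- `v` is the maximum of the posterior `l`-guess-error-probability over the channels whose
pre-images have at most `k` elements: no channel exceeds it, whatever its (finite or infinite)
discrete output alphabet, and some channel with a finite alphabet attains it. -/
def IsMaxPosteriorGuessError {n : ℕ} (p : Fin n → ℝ) (k l : ℕ) (v : ℝ) : Prop :=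
  (∃ (m : ℕ) (W : Channel n (Fin m)), W.PreImCap k ∧ W.posteriorGuessError p l = v) ∧
  ∀ (Y : Type u) (W : Channel n Y), W.PreImCap k → W.posteriorGuessError p l ≤ v

end

/-! The tool throughout is duality: the sum of the `l` largest entries of `v` is the minimum over
`t` of `l * t + ∑ x, max (v x - t) 0`.

Upper bound: fix a set `J` of `j ≤ l` secrets and put `r = (l - j) / (k - j)`. Weights `1` on `J`
and `r` off `J` lie in `[0, 1]` and total at most `l` on any support of size `≤ k`. Hence at each
output the `l` best guesses capture at least the joint mass of `J` plus `r` times the rest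
(`sum_add_le_dual`); summing over outputs gives the bound for every `J`.

Attainment: choose `c` with `∑ x, min (p x) c = k * c`. Then `min (p x) c / c` is a mixture of
indicators of `k`-sets (`exists_perm_mixture`). Announcing the sampled set gives a channel whose
joint mass at an output is its mixture weight times `max (p x) c` on that set. One threshold `t ≥ c`
thus bounds the success at all outputs simultaneously, and `exists_dual_le_value` picks `t` and `j`
so that the bounds meet. -/

/-! ### Sums of largest entries and their dual -/

open Finset in
theorem topSum_le_dual {n : ℕ} (v : Fin n → ℝ) {l : ℕ} (hl : l ≤ n) (t : ℝ) :
    topSum v l ≤ l * t + ∑ x, max (v x - t) 0 := by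
  have hcard : (univ.filter (fun i : Fin n => (i : ℕ) < l)).card = l := by
    rw [Fin.card_filter_val_lt, min_eq_right hl]
  have hperm : ∑ x, max (v x - t) 0 = ∑ i, max (sortDesc v i - t) 0 :=
    (Equiv.sum_comp (Tuple.sort (fun x => -v x)) (fun x => max (v x - t) 0)).symm
  have h1 : topSum v l ≤
      ∑ i ∈ univ.filter (fun i : Fin n => (i : ℕ) < l), (t + max (sortDesc v i - t) 0) := by
    refine sum_le_sum fun i _ => ?_
    linarith [le_max_left (sortDesc v i - t) 0]
  have h2 : ∑ i ∈ univ.filter (fun i : Fin n => (i : ℕ) < l), max (sortDesc v i - t) 0 ≤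
      ∑ i, max (sortDesc v i - t) 0 :=
    sum_le_sum_of_subset_of_nonneg (filter_subset _ _) fun i _ _ => le_max_right _ _
  rw [sum_add_distrib, sum_const, hcard, nsmul_eq_mul] at h1
  linarith

open Finset in
theorem exists_topSum_eq_dual {n : ℕ} (v : Fin n → ℝ) (hv : ∀ x, 0 ≤ v x) {l : ℕ} (hl : 1 ≤ l)
    (hln : l ≤ n) : ∃ t, 0 ≤ t ∧ topSum v l = l * t + ∑ x, max (v x - t) 0 := by
  have hcard : (univ.filter (fun i : Fin n => (i : ℕ) < l)).card = l := by
    rw [Fin.card_filter_val_lt, min_eq_right hln]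
  obtain ⟨m, hm⟩ : ∃ m : Fin n, (m : ℕ) + 1 = l := ⟨⟨l - 1, by omega⟩, by simp; omega⟩
  -- The optimal threshold is the `l`-th largest entry, at zero-based index `l - 1`.
  refine ⟨sortDesc v m, hv _, ?_⟩
  set t := sortDesc v m
  have hperm : ∑ x, max (v x - t) 0 = ∑ i, max (sortDesc v i - t) 0 :=
    (Equiv.sum_comp (Tuple.sort (fun x => -v x)) (fun x => max (v x - t) 0)).symm
  have h2 : ∑ i, max (sortDesc v i - t) 0 =
      ∑ i ∈ univ.filter (fun i : Fin n => (i : ℕ) < l), (sortDesc v i - t) := by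
    rw [sum_filter]
    refine sum_congr rfl fun i _ => ?_
    split_ifs with h
    · exact max_eq_left (sub_nonneg.2 (sortDesc_antitone v (Fin.le_def.2 (by omega))))
    · exact max_eq_right (sub_nonpos.2 (sortDesc_antitone v (Fin.le_def.2 (by omega))))
  rw [hperm, h2, sum_sub_distrib, sum_const, hcard, nsmul_eq_mul, topSum]
  ring

open Finset in
theorem sum_le_topSum {n : ℕ} (v : Fin n → ℝ) (hv : ∀ x, 0 ≤ v x) {l : ℕ} (hln : l ≤ n)
    (B : Finset (Fin n)) (hB : B.card ≤ l) : ∑ x ∈ B, v x ≤ topSum v l := by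
  rcases Nat.eq_zero_or_pos l with rfl | hl
  · have : B = ∅ := by simpa using hB
    simp [this, topSum]
  obtain ⟨t, ht, h⟩ := exists_topSum_eq_dual v hv hl hln
  have h1 : ∑ x ∈ B, v x ≤ ∑ x ∈ B, (t + max (v x - t) 0) :=
    sum_le_sum fun x _ => by linarith [le_max_left (v x - t) 0]
  have h2 : ∑ x ∈ B, max (v x - t) 0 ≤ ∑ x, max (v x - t) 0 :=
    sum_le_sum_of_subset_of_nonneg (subset_univ _) fun i _ _ => le_max_right _ _
  have h3 : (B.card : ℝ) * t ≤ l * t := by gcongr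
  rw [sum_add_distrib, sum_const, nsmul_eq_mul] at h1
  linarith

open Finset in
theorem exists_sum_eq_topSum {n : ℕ} (v : Fin n → ℝ) {j : ℕ} (hj : j ≤ n) :
    ∃ J : Finset (Fin n), J.card = j ∧ ∑ x ∈ J, v x = topSum v j := by
  refine ⟨(univ.filter (fun i : Fin n => (i : ℕ) < j)).map
    (Tuple.sort (fun x => -v x)).toEmbedding, ?_, ?_⟩
  · rw [card_map, Fin.card_filter_val_lt, min_eq_right hj]
  · rw [sum_map]; rfl

open Finset in
/-- A vector whose support has at most `k` elements carries, on its `l` largest entries, at least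
the mass of any `j`-set plus the fraction `(l - j) / (k - j)` of the remaining mass. -/
theorem sum_add_le_dual {n : ℕ} (a : Fin n → ℝ) {k l : ℕ}
    (J A : Finset (Fin n)) (hA : ∀ x, x ∉ A → a x = 0) (hAk : A.card ≤ k) (hJl : J.card ≤ l)
    (hlk : l ≤ k) {t : ℝ} (ht : 0 ≤ t) :
    ∑ x ∈ J, a x + (((l : ℝ) - J.card) / ((k : ℝ) - J.card)) * ∑ x ∈ Jᶜ, a x ≤
      l * t + ∑ x, max (a x - t) 0 := by
  set r := ((l : ℝ) - J.card) / ((k : ℝ) - J.card) with hr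
  have hJl' : (J.card : ℝ) ≤ l := by exact_mod_cast hJl
  have hlk' : (l : ℝ) ≤ k := by exact_mod_cast hlk
  have hAk' : (A.card : ℝ) ≤ k := by exact_mod_cast hAk
  have hr0 : 0 ≤ r := div_nonneg (by linarith) (by linarith)
  have hr1 : r ≤ 1 := div_le_one_of_le₀ (by linarith) (by linarith)
  -- If `k = J.card`, then `r = 0` by the convention for division by zero.
  have hrl : r * ((k : ℝ) - J.card) ≤ l - J.card := by
    rcases eq_or_ne ((k : ℝ) - J.card) 0 with h | h
    · rw [h]; linarith
    · rw [hr, div_mul_cancel₀ _ h]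
  have key : ∀ B : Finset (Fin n), ∑ x ∈ B, a x ≤
      ((A ∩ B).card : ℝ) * t + ∑ x ∈ B, max (a x - t) 0 := by
    intro B
    have h0 : ((A ∩ B).card : ℝ) * t = ∑ x ∈ B, if x ∈ A then t else 0 := by
      rw [← sum_filter, sum_const, nsmul_eq_mul, inter_comm, filter_mem_eq_inter]
    rw [h0, ← sum_add_distrib]
    refine sum_le_sum fun x _ => ?_
    split_ifs with h
    · linarith [le_max_left (a x - t) 0]
    · rw [hA x h, zero_add]; exact le_max_right _ _
  have hc : ((A ∩ J).card : ℝ) + (A ∩ Jᶜ).card ≤ k := by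
    have : (A ∩ J).card + (A ∩ Jᶜ).card = A.card := by
      rw [← card_union_of_disjoint, ← inter_union_distrib_left, union_compl, inter_univ]
      exact disjoint_of_subset_left inter_subset_right
        (disjoint_of_subset_right inter_subset_right disjoint_compl_right)
    rw [← this] at hAk'
    exact_mod_cast hAk'
  have hcJ : ((A ∩ J).card : ℝ) ≤ J.card := by exact_mod_cast card_le_card inter_subset_right
  -- Since `r ≤ 1`, the total weight on `A` is largest when `A` contains `J` and has `k` elements.
  have hw : ((A ∩ J).card : ℝ) + r * (A ∩ Jᶜ).card ≤ l := by nlinarith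
  have hsplit := sum_add_sum_compl J fun x => max (a x - t) 0
  have hpos : 0 ≤ ∑ x ∈ Jᶜ, max (a x - t) 0 := sum_nonneg fun i _ => le_max_right _ _
  have h1 := key J
  have h2 := mul_le_mul_of_nonneg_left (key Jᶜ) hr0
  have h3 := mul_le_mul_of_nonneg_right hw ht
  have h4 := mul_le_mul_of_nonneg_right hr1 hpos
  nlinarith

/-! ### Channels and the upper bound -/

namespace Channel

variable {n : ℕ} {Y : Type*}

theorem outProb_nonneg (W : Channel n Y) {p : Fin n → ℝ} (hp : ∀ x, 0 < p x) (y : Y) :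
    0 ≤ W.outProb p y :=
  Finset.sum_nonneg fun x _ => mul_nonneg (hp x).le (W.prob_nonneg x y)

theorem outProb_pos (W : Channel n Y) {p : Fin n → ℝ} (hp : ∀ x, 0 < p x) {y : Y}
    (hy : y ∈ W.posOutputs) : 0 < W.outProb p y := by
  obtain ⟨x, hx⟩ := hy
  exact Finset.sum_pos' (fun x _ => mul_nonneg (hp x).le (W.prob_nonneg x y))
    ⟨x, Finset.mem_univ _, mul_pos (hp x) hx⟩

theorem outProb_eq_zero (W : Channel n Y) (p : Fin n → ℝ) {y : Y}
    (hy : y ∉ W.posOutputs) : W.outProb p y = 0 := by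
  refine Finset.sum_eq_zero fun x _ => ?_
  have : ¬ 0 < W.prob x y := fun h => hy ⟨x, h⟩
  rw [le_antisymm (not_lt.1 this) (W.prob_nonneg x y), mul_zero]

theorem hasSum_outProb (W : Channel n Y) {p : Fin n → ℝ} (hp : ∑ x, p x = 1) :
    HasSum (W.outProb p) 1 := by
  have := hasSum_sum (s := Finset.univ) fun x _ => (W.prob_hasSum x).mul_left (p x)
  simp only [mul_one, hp] at this
  exact this

/-- The dual is positively homogeneous, so Bayes' denominator cancels and later estimates involve
only joint masses. -/
theorem mul_dual_posterior (W : Channel n Y) {p : Fin n → ℝ} {y : Y} (hy : 0 < W.outProb p y)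
    (l : ℕ) (t : ℝ) :
    W.outProb p y * (l * t + ∑ x, max (W.posterior p y x - t) 0) =
      l * (W.outProb p y * t) + ∑ x, max (p x * W.prob x y - W.outProb p y * t) 0 := by
  rw [mul_add, Finset.mul_sum]
  congr 1
  · ring
  · refine Finset.sum_congr rfl fun x _ => ?_
    rw [mul_max_of_nonneg _ _ hy.le, mul_zero, mul_sub, posterior, mul_div_cancel₀ _ hy.ne']

theorem posterior_nonneg (W : Channel n Y) {p : Fin n → ℝ} (hp : ∀ x, 0 < p x) (y : Y)
    (x : Fin n) : 0 ≤ W.posterior p y x :=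
  div_nonneg (mul_nonneg (hp x).le (W.prob_nonneg x y)) (W.outProb_nonneg hp y)

theorem mul_guessError_ge (W : Channel n Y) {p : Fin n → ℝ} (hp : ∀ x, 0 < p x) {y : Y}
    (hy : y ∈ W.posOutputs) {l : ℕ} (hln : l ≤ n) (t : ℝ) :
    W.outProb p y - (l * t + ∑ x, max (p x * W.prob x y - t) 0) ≤
      W.outProb p y * guessError l (W.posterior p y) := by
  have h0 := W.outProb_pos hp hy
  have h1 := mul_le_mul_of_nonneg_left
    (topSum_le_dual (W.posterior p y) hln (t / W.outProb p y)) h0.le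
  rw [W.mul_dual_posterior h0, mul_div_cancel₀ _ h0.ne'] at h1
  rw [guessError, mul_sub, mul_one]
  linarith

theorem exists_mul_guessError_eq (W : Channel n Y) {p : Fin n → ℝ} (hp : ∀ x, 0 < p x) {y : Y}
    (hy : y ∈ W.posOutputs) {l : ℕ} (hl : 1 ≤ l) (hln : l ≤ n) :
    ∃ t, 0 ≤ t ∧ W.outProb p y * guessError l (W.posterior p y) =
      W.outProb p y - (l * t + ∑ x, max (p x * W.prob x y - t) 0) := by
  have h0 := W.outProb_pos hp hy
  obtain ⟨t, ht, h⟩ := exists_topSum_eq_dual (W.posterior p y) (W.posterior_nonneg hp y) hl hln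
  refine ⟨W.outProb p y * t, mul_nonneg h0.le ht, ?_⟩
  rw [← W.mul_dual_posterior h0, ← h, guessError]
  ring

theorem mul_guessError_nonneg (W : Channel n Y) {p : Fin n → ℝ} (hp : ∀ x, 0 < p x) {y : Y}
    (hy : y ∈ W.posOutputs) {l : ℕ} (hln : l ≤ n) :
    0 ≤ W.outProb p y * guessError l (W.posterior p y) := by
  refine le_trans (le_of_eq ?_) (W.mul_guessError_ge hp hy hln 0)
  rw [outProb, mul_zero, zero_add, ← Finset.sum_sub_distrib]
  refine (Finset.sum_eq_zero fun x _ => ?_).symm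
  rw [sub_zero, max_eq_left (mul_nonneg (hp x).le (W.prob_nonneg x y)), sub_self]

/-- The pre-image of an output as a finite set: outside of it, the joint probability vanishes. -/
theorem PreImCap.exists_support {W : Channel n Y} {k : ℕ} (h : W.PreImCap k) (y : Y) :
    ∃ A : Finset (Fin n), A.card ≤ k ∧ ∀ x ∉ A, W.prob x y = 0 := by
  classical
  refine ⟨(W.preIm y).toFinset, ?_, fun x hx => ?_⟩
  · rw [← Set.ncard_eq_toFinset_card']; exact h y
  · have : ¬ 0 < W.prob x y := fun h => hx (Set.mem_toFinset.2 h)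
    exact le_antisymm (not_lt.1 this) (W.prob_nonneg x y)

theorem PreImCap.mul_guessError_le {W : Channel n Y} {k l : ℕ} (h : W.PreImCap k)
    {p : Fin n → ℝ} (hp : ∀ x, 0 < p x) (hl : 1 ≤ l) (hln : l ≤ n) (hlk : l ≤ k)
    (J : Finset (Fin n)) (hJ : J.card ≤ l) {y : Y} (hy : y ∈ W.posOutputs) :
    W.outProb p y * guessError l (W.posterior p y) ≤
      (1 - ((l : ℝ) - J.card) / ((k : ℝ) - J.card)) * ∑ x ∈ Jᶜ, p x * W.prob x y := by
  obtain ⟨t, ht, he⟩ := W.exists_mul_guessError_eq hp hy hl hln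
  obtain ⟨A, hAk, hA⟩ := h.exists_support y
  have h1 := sum_add_le_dual (fun x => p x * W.prob x y) J A
    (fun x hx => by rw [hA x hx, mul_zero]) hAk hJ hlk ht
  have h2 : _ = W.outProb p y := Finset.sum_add_sum_compl J fun x => p x * W.prob x y
  rw [he, ← h2]
  linarith

theorem PreImCap.posteriorGuessError_le {W : Channel n Y} {k l : ℕ} (h : W.PreImCap k)
    {p : Fin n → ℝ} (hp : ∀ x, 0 < p x) (hl : 1 ≤ l) (hln : l ≤ n) (hlk : l ≤ k)
    (J : Finset (Fin n)) (hJ : J.card ≤ l) :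
    W.posteriorGuessError p l ≤
      (1 - ((l : ℝ) - J.card) / ((k : ℝ) - J.card)) * ∑ x ∈ Jᶜ, p x := by
  have hJl' : (J.card : ℝ) ≤ l := by exact_mod_cast hJ
  have hlk' : (l : ℝ) ≤ k := by exact_mod_cast hlk
  have hr1 : ((l : ℝ) - J.card) / ((k : ℝ) - J.card) ≤ 1 :=
    div_le_one_of_le₀ (by linarith) (by linarith)
  set r := ((l : ℝ) - J.card) / ((k : ℝ) - J.card)
  have hs : HasSum (fun y => (1 - r) * ∑ x ∈ Jᶜ, p x * W.prob x y)
      ((1 - r) * ∑ x ∈ Jᶜ, p x) := by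
    have := hasSum_sum (s := Jᶜ) fun x _ => (W.prob_hasSum x).mul_left (p x)
    simpa using this.mul_left (1 - r)
  have hnn : ∀ y, 0 ≤ (1 - r) * ∑ x ∈ Jᶜ, p x * W.prob x y := fun y =>
    mul_nonneg (by linarith)
      (Finset.sum_nonneg fun x _ => mul_nonneg (hp x).le (W.prob_nonneg x y))
  have hsub : Summable fun y : W.posOutputs => (1 - r) * ∑ x ∈ Jᶜ, p x * W.prob x y :=
    hs.summable.subtype _
  have hle : ∀ y : W.posOutputs, W.outProb p y * guessError l (W.posterior p y) ≤
      (1 - r) * ∑ x ∈ Jᶜ, p x * W.prob x y := fun y => h.mul_guessError_le hp hl hln hlk J hJ y.2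
  refine ((hsub.of_nonneg_of_le (fun y => W.mul_guessError_nonneg hp y.2 hln) hle).tsum_le_tsum
    hle hsub).trans ?_
  rw [← hs.tsum_eq]
  exact hs.summable.tsum_subtype_le _ _ hnn

theorem PreImCap.posteriorGuessError_nonpos {W : Channel n Y} {k l : ℕ} (h : W.PreImCap k)
    {p : Fin n → ℝ} (hp : ∀ x, 0 < p x) (hl : 1 ≤ l) (hln : l ≤ n) (hkl : k ≤ l) :
    W.posteriorGuessError p l ≤ 0 := by
  -- With the cap relaxed to `l` and `J = ∅`, the ratio is `l / l = 1` and the bound vanishes.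
  have hcap : W.PreImCap l := fun y => (h y).trans hkl
  have h1 := hcap.posteriorGuessError_le hp hl hln le_rfl ∅ (by simp)
  have : (l : ℝ) / l = 1 := div_self (by positivity)
  simpa [this] using h1

theorem posteriorGuessError_nonneg (W : Channel n Y) {p : Fin n → ℝ} (hp : ∀ x, 0 < p x)
    {l : ℕ} (hln : l ≤ n) : 0 ≤ W.posteriorGuessError p l :=
  tsum_nonneg fun y => W.mul_guessError_nonneg hp y.2 hln

/-- The channel that reveals the secret. -/
def identity (n : ℕ) : Channel n (Fin n) where
  prob x y := if y = x then 1 else 0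
  prob_nonneg x y := by split_ifs <;> norm_num
  prob_hasSum x := hasSum_ite_eq x 1

theorem identity_preImCap (n : ℕ) : (identity n).PreImCap 1 := by
  intro y
  refine (Set.ncard_le_one).2 fun a ha b hb => ?_
  have key : ∀ c, c ∈ (identity n).preIm y → y = c := by
    intro c hc
    by_contra hne
    simp [preIm, identity, hne] at hc
  rw [← key a ha, ← key b hb]

end Channel

/-! ### Construction of an optimal channel -/

open Finset in
/-- A vector with entries in `[0, 1]` and integral sum `k` is a mixture of indicator vectors of
`k`-sets, by Birkhoff's theorem. -/
theorem exists_perm_mixture {n k : ℕ} (hk : 1 ≤ k) (hkn : k ≤ n) (q : Fin n → ℝ)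
    (hq0 : ∀ x, 0 ≤ q x) (hq1 : ∀ x, q x ≤ 1) (hq : ∑ x, q x = k) :
    ∃ w : Equiv.Perm (Fin n) → ℝ, (∀ σ, 0 ≤ w σ) ∧ ∑ σ, w σ = 1 ∧
      ∀ x, ∑ σ, w σ * (if (σ.symm x : ℕ) < k then 1 else 0) = q x := by
  have hk0 : (k : ℝ) ≠ 0 := by positivity
  have hkn' : (k : ℝ) ≤ n := by exact_mod_cast hkn
  have hcard : (univ.filter (fun i : Fin n => (i : ℕ) < k)).card = k := by
    rw [Fin.card_filter_val_lt, min_eq_right hkn]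
  have hcard' : ((univ.filter (fun i : Fin n => ¬ (i : ℕ) < k)).card : ℝ) = n - k := by
    have := card_filter_add_card_filter_not (s := (univ : Finset (Fin n)))
      (fun i : Fin n => (i : ℕ) < k)
    rw [hcard, card_univ, Fintype.card_fin] at this
    rw [eq_sub_iff_add_eq']; exact_mod_cast this
  have hdef : ∑ x, (1 - q x) = n - k := by simp [sum_sub_distrib, hq]
  -- The first `k` rows share `q` equally and the others share `1 - q`, so each column sums to `1`.
  -- A permutation then selects the `k`-set of images of the first `k` indices.
  have hM : (Matrix.of fun i x : Fin n =>
      if (i : ℕ) < k then q x / k else (1 - q x) / (n - k)) ∈ doublyStochastic ℝ (Fin n) := by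
    rw [mem_doublyStochastic_iff_sum]
    refine ⟨fun i x => ?_, fun i => ?_, fun x => ?_⟩
    · simp only [Matrix.of_apply]
      split_ifs
      · exact div_nonneg (hq0 x) (by positivity)
      · exact div_nonneg (by linarith [hq1 x]) (by linarith)
    · simp only [Matrix.of_apply]
      split_ifs with h
      · rw [← sum_div, hq, div_self hk0]
      · rw [← sum_div, hdef, div_self]
        have : (k : ℝ) < n := by exact_mod_cast (not_lt.1 h).trans_lt i.2
        linarith
    · simp only [Matrix.of_apply]
      rw [sum_ite, sum_const, sum_const, nsmul_eq_mul, nsmul_eq_mul, hcard, hcard',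
        mul_div_cancel₀ _ hk0]
      rcases eq_or_ne ((n : ℝ) - k) 0 with h | h
      · rw [h] at hdef
        have := (sum_eq_zero_iff_of_nonneg fun x _ => sub_nonneg.2 (hq1 x)).1 hdef x (mem_univ _)
        rw [h]; linarith
      · rw [mul_div_cancel₀ _ h]; ring
  obtain ⟨w, hw0, hw1, hw⟩ := exists_eq_sum_perm_of_mem_doublyStochastic hM
  refine ⟨w, hw0, hw1, fun x => ?_⟩
  have hrow : ∀ i : Fin n, (i : ℕ) < k → ∑ σ, w σ * (if σ i = x then 1 else 0) = q x / k := by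
    intro i hi
    have := congrFun (congrFun hw i) x
    simpa [Matrix.sum_apply, hi, Equiv.Perm.permMatrix, PEquiv.toMatrix_apply, eq_comm] using this
  have hσ : ∀ σ : Equiv.Perm (Fin n), (if (σ.symm x : ℕ) < k then (1 : ℝ) else 0) =
      ∑ i ∈ univ.filter (fun i : Fin n => (i : ℕ) < k), if σ i = x then 1 else 0 := by
    intro σ
    simp [← Equiv.eq_symm_apply]
  simp_rw [hσ, mul_sum]
  rw [sum_comm, sum_congr rfl fun i hi => hrow i (mem_filter.1 hi).2, sum_const, hcard,
    nsmul_eq_mul, mul_div_cancel₀ _ hk0]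

open Finset in
theorem exists_sum_min_eq {n k : ℕ} {p : Fin n → ℝ} (hp : ∀ x, 0 < p x) (hsum : ∑ x, p x = 1)
    (hk : 1 ≤ k) (hkn : k ≤ n) : ∃ c, 0 < c ∧ ∑ x, min (p x) c = k * c := by
  have : Nonempty (Fin n) := ⟨⟨0, by omega⟩⟩
  have hk0 : (0 : ℝ) < k := by exact_mod_cast hk
  have hkn' : (k : ℝ) ≤ n := by exact_mod_cast hkn
  obtain ⟨m, hm⟩ := Finite.exists_min p
  have hnm : (n : ℝ) * p m ≤ 1 := by
    have := sum_le_sum fun x (_ : x ∈ univ) => hm x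
    simpa [hsum] using this
  have hmk : p m ≤ 1 / k := by
    rw [le_div_iff₀ hk0]
    nlinarith [hp m]
  -- At the least entry `p m` the difference is `(n - k) * p m ≥ 0`; at `1 / k` it is at most `1 -
  -- 1`.
  have hcont : ContinuousOn (fun c => ∑ x, min (p x) c - k * c) (Set.Icc (p m) (1 / k)) := by
    fun_prop
  have h0 : ∑ x, min (p x) (p m) - k * p m ≥ 0 := by
    have : ∑ x, min (p x) (p m) = n * p m := by simp [hm]
    rw [this]
    nlinarith [hp m]
  have h1 : ∑ x, min (p x) (1 / (k : ℝ)) - k * (1 / k) ≤ 0 := by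
    have := sum_le_sum fun x (_ : x ∈ univ) => min_le_left (p x) (1 / (k : ℝ))
    rw [hsum] at this
    rw [mul_one_div_cancel hk0.ne']
    linarith
  obtain ⟨c, hc, h⟩ := intermediate_value_Icc' hmk hcont ⟨h1, h0⟩
  exact ⟨c, (hp m).trans_le hc.1, sub_eq_zero.1 h⟩

open Finset in
/-- A channel with capped pre-images whose posteriors are flat below the level `c`. -/
theorem exists_channel_posteriorGuessError_ge {n k l : ℕ} {p : Fin n → ℝ} (hp : ∀ x, 0 < p x)
    (hsum : ∑ x, p x = 1) (hk : 1 ≤ k) (hkn : k ≤ n) (hln : l ≤ n) {c : ℝ} (hc0 : 0 < c)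
    (hc : ∑ x, min (p x) c = k * c) :
    ∃ (m : ℕ) (W : Channel n (Fin m)), W.PreImCap k ∧
      ∀ t, c ≤ t → 1 - (l * t + ∑ x, max (p x - t) 0) ≤ W.posteriorGuessError p l := by
  have hq0 : ∀ x, 0 < min (p x) c / c := fun x => div_pos (lt_min (hp x) hc0) hc0
  obtain ⟨w, hw0, hw1, hw⟩ := exists_perm_mixture hk hkn (fun x => min (p x) c / c)
    (fun x => (hq0 x).le) (fun x => (div_le_one hc0).2 (min_le_right _ _))
    (by rw [← sum_div, hc, mul_div_cancel_right₀ _ hc0.ne'])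
  let e := Fintype.equivFin (Equiv.Perm (Fin n))
  let W : Channel n (Fin (Fintype.card (Equiv.Perm (Fin n)))) :=
    { prob := fun x y =>
        w (e.symm y) * (if ((e.symm y).symm x : ℕ) < k then 1 else 0) / (min (p x) c / c)
      prob_nonneg := fun x y => div_nonneg (mul_nonneg (hw0 _) (by split_ifs <;> norm_num))
        (hq0 x).le
      prob_hasSum := fun x => by
        have h := hasSum_fintype (fun σ : Equiv.Perm (Fin n) =>
          w σ * (if (σ.symm x : ℕ) < k then 1 else 0) / (min (p x) c / c))
        rw [← sum_div, hw, div_self (hq0 x).ne'] at h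
        exact (Equiv.hasSum_iff e.symm).2 h }
  refine ⟨_, W, fun y => ?_, fun t ht => ?_⟩
  · have hsub : W.preIm y ⊆
        ((univ.filter (fun i : Fin n => (i : ℕ) < k)).map (e.symm y).toEmbedding :
          Finset (Fin n)) := by
      intro x hx
      have hx' : ((e.symm y).symm x : ℕ) < k := by
        by_contra hne
        simp [Channel.preIm, W, hne] at hx
      simp only [coe_map, Set.mem_image, mem_coe, mem_filter, mem_univ, true_and]
      exact ⟨_, hx', (e.symm y).apply_symm_apply x⟩
    refine (Set.ncard_le_ncard hsub (finite_toSet _)).trans ?_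
    rw [Set.ncard_coe_finset, card_map, Fin.card_filter_val_lt, min_eq_right hkn]
  · set M := (l : ℝ) * t + ∑ x, max (p x - t) 0 with hM
    have ht0 : 0 ≤ t := hc0.le.trans ht
    have hM0 : 0 ≤ M := add_nonneg (by positivity) (sum_nonneg fun x _ => le_max_right _ _)
    have hjoint : ∀ x y, p x * W.prob x y - w (e.symm y) * t ≤
        w (e.symm y) * max (p x - t) 0 := by
      intro x y
      have hmm : p x / (min (p x) c / c) = max (p x) c := by
        rw [div_div_eq_mul_div, div_eq_iff (lt_min (hp x) hc0).ne', max_mul_min]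
      have hle : p x * W.prob x y ≤ w (e.symm y) * max (p x) c := by
        have : p x * W.prob x y = w (e.symm y) * max (p x) c *
            (if ((e.symm y).symm x : ℕ) < k then 1 else 0) := by
          rw [← hmm]; simp only [W]; ring
        rw [this]
        refine mul_le_of_le_one_right
          (mul_nonneg (hw0 _) (hc0.le.trans (le_max_right _ _))) ?_
        split_ifs <;> norm_num
      have hmt : max (p x) c ≤ t + max (p x - t) 0 := by
        refine max_le ?_ ?_
        · linarith [le_max_left (p x - t) 0]
        · linarith [le_max_right (p x - t) 0]
      have := mul_le_mul_of_nonneg_left hmt (hw0 (e.symm y))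
      linarith
    have hterm : ∀ y, W.outProb p y - w (e.symm y) * M ≤
        W.posOutputs.indicator (fun y => W.outProb p y * guessError l (W.posterior p y)) y := by
      intro y
      by_cases hy : y ∈ W.posOutputs
      · rw [Set.indicator_of_mem hy]
        refine le_trans ?_ (W.mul_guessError_ge hp hy hln (w (e.symm y) * t))
        have : ∑ x, max (p x * W.prob x y - w (e.symm y) * t) 0 ≤
            w (e.symm y) * ∑ x, max (p x - t) 0 := by
          rw [mul_sum]
          exact sum_le_sum fun x _ =>
            max_le (hjoint x y) (mul_nonneg (hw0 _) (le_max_right _ _))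
        rw [hM]
        linarith
      · rw [Set.indicator_of_notMem hy, W.outProb_eq_zero p hy, zero_sub, neg_nonpos]
        exact mul_nonneg (hw0 _) hM0
    have hout : ∑ y, W.outProb p y = 1 := by
      exact (hasSum_fintype _).unique (W.hasSum_outProb hsum)
    have hwsum : ∑ y, w (e.symm y) = 1 := by rw [Equiv.sum_comp e.symm w, hw1]
    have := sum_le_sum fun y (_ : y ∈ univ) => hterm y
    rw [sum_sub_distrib, ← sum_mul, hout, hwsum, one_mul] at this
    rw [Channel.posteriorGuessError,
      tsum_subtype W.posOutputs (fun y => W.outProb p y * guessError l (W.posterior p y)),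
      tsum_fintype]
    exact this

-- If at most `l` entries exceed `c`, take `t = c` and `j` their number: the mass outside them is
-- `(k - j) * c` by the choice of `c`. Otherwise `j = l`, with `t` dual-optimal for `p`.
open Finset in
theorem exists_dual_le_value {n k l : ℕ} {p : Fin n → ℝ} (hp : ∀ x, 0 < p x)
    (hsum : ∑ x, p x = 1) (hl : 1 ≤ l) (hln : l ≤ n) (hlk : l ≤ k) {c : ℝ}
    (hc : ∑ x, min (p x) c = k * c) :
    ∃ j ≤ l, ∃ t, c ≤ t ∧ l * t + ∑ x, max (p x - t) 0 ≤
      topSum p j + (1 - topSum p j) * (((l : ℝ) - (j : ℝ)) / ((k : ℝ) - (j : ℝ))) := by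
  classical
  set J := univ.filter fun x => c < p x with hJ
  have hdual : ∑ x, max (p x - c) 0 = ∑ x ∈ J, p x - J.card * c := by
    rw [← nsmul_eq_mul, ← sum_const, ← sum_sub_distrib, hJ, sum_filter]
    refine sum_congr rfl fun x _ => ?_
    split_ifs with h
    · exact max_eq_left (by linarith)
    · exact max_eq_right (by linarith)
  by_cases hJl : J.card ≤ l
  · refine ⟨J.card, hJl, c, le_rfl, ?_⟩
    have hT := sum_le_topSum p (fun x => (hp x).le) (hJl.trans hln) J le_rfl
    have hck : 1 - ∑ x ∈ J, p x = (k - J.card) * c := by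
      have h1 : ∑ x, min (p x) c + ∑ x, max (p x - c) 0 = 1 := by
        rw [← sum_add_distrib, ← hsum]
        refine sum_congr rfl fun x _ => ?_
        rcases le_total (p x) c with h | h
        · rw [min_eq_left h, max_eq_right (by linarith), add_zero]
        · rw [min_eq_right h, max_eq_left (by linarith)]; ring
      linarith
    have hJl' : (J.card : ℝ) ≤ l := by exact_mod_cast hJl
    have hlk' : (l : ℝ) ≤ k := by exact_mod_cast hlk
    have hr1 : ((l : ℝ) - J.card) / ((k : ℝ) - J.card) ≤ 1 :=
      div_le_one_of_le₀ (by linarith) (by linarith)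
    have hrl : ((l : ℝ) - J.card) / ((k : ℝ) - J.card) * ((k : ℝ) - J.card) = l - J.card := by
      rcases eq_or_ne ((k : ℝ) - J.card) 0 with h | h
      · rw [h]; linarith
      · rw [div_mul_cancel₀ _ h]
    set r := ((l : ℝ) - J.card) / ((k : ℝ) - J.card)
    rw [hdual]
    have h2 : (l - J.card) * c = r * (1 - ∑ x ∈ J, p x) := by rw [hck, ← hrl]; ring
    have h3 := mul_le_mul_of_nonneg_left hT (sub_nonneg.2 hr1)
    linarith
  · obtain ⟨t, -, ht⟩ := exists_topSum_eq_dual p (fun x => (hp x).le) hl hln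
    refine ⟨l, le_rfl, t, ?_, by rw [← ht]; simp⟩
    -- More than `l` entries exceed `c`, so the dual at any `t < c` is strictly larger than at `c`,
    -- contradicting optimality.
    by_contra! htc
    have h1 := topSum_le_dual p hln c
    have h2 : ∑ x ∈ J, (p x - t) ≤ ∑ x, max (p x - t) 0 :=
      (sum_le_sum fun x _ => le_max_left _ _).trans
        (sum_le_sum_of_subset_of_nonneg (subset_univ _) fun i _ _ => le_max_right _ _)
    rw [sum_sub_distrib, sum_const, nsmul_eq_mul] at h2
    have h3 : (l : ℝ) < J.card := by exact_mod_cast not_le.1 hJl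
    nlinarith

theorem posteriorGuessError_le_value {n k l : ℕ} {p : Fin n → ℝ} {Y : Type*} {W : Channel n Y}
    (hp : ∀ x, 0 < p x) (hsum : ∑ x, p x = 1) (hl : 1 ≤ l) (hln : l ≤ n) (hlk : l ≤ k)
    (hW : W.PreImCap k) :
    W.posteriorGuessError p l ≤
      1 - (Finset.Icc 0 l).sup' (Finset.nonempty_Icc.mpr (Nat.zero_le l))
        (fun j : ℕ =>
          topSum p j + (1 - topSum p j) * (((l : ℝ) - (j : ℝ)) / ((k : ℝ) - (j : ℝ)))) := by
  rw [le_sub_comm]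
  refine Finset.sup'_le _ _ fun j hj => ?_
  have hjl := (Finset.mem_Icc.1 hj).2
  obtain ⟨J, rfl, hJ⟩ := exists_sum_eq_topSum p (hjl.trans hln)
  have h := hW.posteriorGuessError_le hp hl hln hlk J hjl
  have h2 := Finset.sum_add_sum_compl J p
  rw [hsum, hJ] at h2
  rw [eq_sub_iff_add_eq'.2 h2] at h
  linarith

theorem mainTheorem6 (n k l : ℕ) (p : Fin n → ℝ)
    (hp_pos : ∀ x, 0 < p x) (hp_sum : ∑ x, p x = 1)
    (hk : 1 ≤ k) (hkn : k ≤ n) (hl : 1 ≤ l) (hln : l ≤ n) :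
    (l ≤ k →
      IsMaxPosteriorGuessError.{u} p k l
        (1 - (Finset.Icc 0 l).sup' (Finset.nonempty_Icc.mpr (Nat.zero_le l))
          (fun j : ℕ =>
            topSum p j + (1 - topSum p j) * (((l : ℝ) - (j : ℝ)) / ((k : ℝ) - (j : ℝ)))))) ∧
    (k < l → IsMaxPosteriorGuessError.{u} p k l 0) := by
  refine ⟨fun hlk => ?_, fun hkl => ⟨⟨n, Channel.identity n, ?_, ?_⟩, fun Y W hW => ?_⟩⟩
  · have hupper : ∀ (Y : Type u) (W : Channel n Y), W.PreImCap k → W.posteriorGuessError p l ≤ _ :=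
      fun Y W hW => posteriorGuessError_le_value hp_pos hp_sum hl hln hlk hW
    obtain ⟨c, hc0, hc⟩ := exists_sum_min_eq hp_pos hp_sum hk hkn
    obtain ⟨m, W, hW, hge⟩ :=
      exists_channel_posteriorGuessError_ge (l := l) hp_pos hp_sum hk hkn hln hc0 hc
    obtain ⟨j, hj, t, ht, hle⟩ := exists_dual_le_value hp_pos hp_sum hl hln hlk hc
    refine ⟨⟨m, W, hW, ?_⟩, hupper⟩
    refine le_antisymm (posteriorGuessError_le_value hp_pos hp_sum hl hln hlk hW) ?_
    refine le_trans ?_ (hge t ht)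
    have := Finset.le_sup' (fun j : ℕ =>
      topSum p j + (1 - topSum p j) * (((l : ℝ) - (j : ℝ)) / ((k : ℝ) - (j : ℝ))))
      (Finset.mem_Icc.2 ⟨Nat.zero_le j, hj⟩)
    linarith
  · exact fun y => (Channel.identity_preImCap n y).trans hk
  · exact le_antisymm
      ((Channel.identity_preImCap n).posteriorGuessError_nonpos hp_pos hl hln hl)
      (Channel.posteriorGuessError_nonneg _ hp_pos hln)
  · exact hW.posteriorGuessError_nonpos hp_pos hl hln hkl.le
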